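/- **Setting.** Fix $\varepsilon\in(0,\tfrac12)$. For probability laws $P,H$ on $\mathbb R$ let $P\odot_\varepsilon H=(1-\varepsilon)P+\varepsilon H$ and let $m(P)$ be the mean of $P$. Let $\mathcal G=\{\mathcal N(x,1):x\in\mathbb R\}$. For a $K$-armed instance $\mu=(\mu_1,\dots,\mu_K)\in\mathcal G^K$ let $m^*(\mu)=\max_a m(\mu_a)$; arm $a$ is suboptimal if $m(\mu_a)<m^*(\mu)$. An algorithm selects, possibly at random, an arm $A_n$ at each round $n$ from the past arms and observations. If $\mathbf H_T=(H_{b,n})_{b\le K,\,n\le T}$ are the corruption laws, the observation in round $n$ is drawn from $\mu_{A_n}\odot_\varepsilon H_{A_n,n}$; $N_a(T)$ is the number of pulls of arm $a$ in the first $T$ rounds and $\mathbb E_{\mu\odot_\varepsilon\mathbf H_T}$ the corresponding expectation. For $\mathbf H\in\mathcal P(\mathbb R)^K$, $\mathbb E_{\mu\odot_\varepsilon\mathbf H}$ refers to corruption laws that are constant in time. The algorithm is *uniformly good* on a class $\mathcal I\subseteq\mathcal G^K$ if for all $\mu\in\mathcal I$, all suboptimal arms $a$ of $\mu$ and all $\alpha>0$,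 $\sup_{\mathbf H_T\in\mathcal P(\mathbb R)^{T\times K}}\mathbb E_{\mu\odot_\varepsilon \mathbf H_T}[N_a(T)]=o(T^\alpha)$ as $T\to\infty$. For $x\le y$ let $$\mathrm{kl}^\varepsilon_{\mathcal G}(x,y)=\inf_{H,H'\in\mathcal P(\mathbb R)}\mathrm{KL}\big(\mathcal N(x,1)\odot_\varepsilon H,\ \mathcal N(y,1)\odot_\varepsilon H'\big),\qquad \tfrac10=\infty .$$ **Claim.** (1) If an algorithm is uniformly good on $\mathcal G^K$, then for every $\mu\in\mathcal G^K$ and every suboptimal arm $a$ of $\mu$, $$\liminf_{T\to\infty}\frac1{\log T}\ \sup_{\mathbf H\in\mathcal P(\mathbb R)^K}\mathbb E_{\mu\odot_\varepsilon\mathbf H}[N_a(T)]\ \ge\ \frac1{\mathrm{kl}^\varepsilon_{\mathcal G}(m(\mu_a),m^*(\mu))}.$$ (2) More generally, the same bound holds for $\mu\in\mathcal I$ and a suboptimal arm $a$ of $\mu$ when the algorithm is only uniformly good on a class $\mathcal I\subseteq\mathcal G^K$ which contains, for every $\delta>0$, an instance obtained from $\mu$ by replacing $\mu_a$ with $\mathcal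 N(y,1)$ for some $y\in(m^*(\mu),m^*(\mu)+\delta)$. (3) For all $x\le y$ the infimum defining $\mathrm{kl}^\varepsilon_{\mathcal G}(x,y)$ is a minimum. Write $\eta=\mathcal N(x,1)$, $\kappa=\mathcal N(y,1)$, and let $\frac{d\eta}{d\kappa}$ be the quotient of their densities. Call $(H_1,H_2)$ a Huber pair if, for some constants $c_1,c_2\ge0$ with $c_1c_2\le1$, $$d(\eta\odot_\varepsilon H_1)=\begin{cases}(1-\varepsilon)\,d\eta&\text{where }\frac{d\eta}{d\kappa}\ge c_1\\ c_1(1-\varepsilon)\,d\kappa&\text{elsewhere}\end{cases},\qquad d(\kappa\odot_\varepsilon H_2)=\begin{cases}(1-\varepsilon)\,d\kappa&\text{where }\frac{d\eta}{d\kappa}\le \frac1{c_2}\\ c_2(1-\varepsilon)\,d\eta&\text{elsewhere.}\end{cases}$$ Every Huber pair attains the minimum, and a Huber pair exists whenever $\mathrm{kl}^\varepsilon_{\mathcal G}(x,y)>0$. -/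

import Mathlib

open MeasureTheory ProbabilityTheory Filter
open scoped ENNReal NNReal Topology

namespace CorruptedBandit

noncomputable section

/-- The corrupted law `P ⊙_ε H = (1 - ε) P + ε H`. -/
def corrupt (ε : ℝ) (P H : ProbabilityMeasure ℝ) : Measure ℝ :=
  (1 - ε).toNNReal • (P : Measure ℝ) + ε.toNNReal • (H : Measure ℝ)

theorem isProbabilityMeasure_corrupt {ε : ℝ} (h0 : 0 ≤ ε) (h1 : ε ≤ 1)
    (P H : ProbabilityMeasure ℝ) : IsProbabilityMeasure (corrupt ε P H) := by
  constructor
  have h : (1 - ε).toNNReal + ε.toNNReal = 1 := by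
    rw [← Real.toNNReal_add (by linarith) h0]; simp
  simp only [corrupt, Measure.add_apply, Measure.smul_apply, measure_univ, ENNReal.smul_def,
    smul_eq_mul, mul_one]
  exact_mod_cast h

/-- The unit-variance Gaussian law with mean `x`. -/
def gaussian (x : ℝ) : ProbabilityMeasure ℝ := ⟨gaussianReal x 1, inferInstance⟩

/-- The family of all unit-variance Gaussian laws. -/
def gaussianFamily : Set (ProbabilityMeasure ℝ) := Set.range gaussian

/-- The mean of a law on `ℝ`. -/
def mean (P : ProbabilityMeasure ℝ) : ℝ := ∫ t, t ∂(P : Measure ℝ)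

/-- The largest mean among the arms of an instance. -/
def bestMean {K : ℕ} (μ : Fin K → ProbabilityMeasure ℝ) : ℝ := ⨆ a, mean (μ a)

/-- The `K`-armed instances all of whose arms lie in the family `L`. -/
def instances (K : ℕ) (L : Set (ProbabilityMeasure ℝ)) :
    Set (Fin K → ProbabilityMeasure ℝ) := {μ | ∀ a, μ a ∈ L}

/-- The past actions and observations after `n` rounds. -/
abbrev History (K n : ℕ) : Type := Fin n → Fin K × ℝ

/-- A (possibly randomised) bandit algorithm: the conditional law of the next action given the
past actions and observations. -/
structure Algorithm (K : ℕ) where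
  policy : (n : ℕ) → Kernel (History K n) (Fin K)
  markov : ∀ n, IsMarkovKernel (policy n)

instance {K : ℕ} (π : Algorithm K) (n : ℕ) : IsMarkovKernel (π.policy n) := π.markov n

/-- The law of the observation given the action, when `ν a` is the observed law of arm `a`. -/
def obsKernel {K : ℕ} (ν : Fin K → Measure ℝ) : Kernel (Fin K) ℝ :=
  Kernel.ofFunOfCountable ν

/-- The joint law of action and observation in round `n`, given the history. -/
def stepKernel {K : ℕ} (π : Algorithm K) (ν : ℕ → Fin K → Measure ℝ) (n : ℕ) :
    Kernel (History K n) (Fin K × ℝ) :=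
  π.policy n ⊗ₖ Kernel.prodMkLeft (History K n) (obsKernel (ν n))

/-- Append the action and observation of the current round to the history. -/
def append {K n : ℕ} (p : History K n × (Fin K × ℝ)) : History K (n + 1) :=
  Fin.snoc (α := fun _ => Fin K × ℝ) p.1 p.2

theorem measurable_append {K n : ℕ} : Measurable (append (K := K) (n := n)) := by
  refine measurable_pi_iff.2 fun i => ?_
  refine Fin.lastCases ?_ (fun j => ?_) i
  · simpa [append] using measurable_snd
  · have h : Measurable fun p : History K n × (Fin K × ℝ) => p.1 j :=
      (measurable_pi_apply j).comp measurable_fst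
    simpa [append] using h

/-- The law of the first `T` actions and observations when algorithm `π` faces the observed arm
laws `ν n` in round `n`. It depends only on `ν 0, …, ν (T - 1)`. -/
def historyLaw {K : ℕ} (π : Algorithm K) (ν : ℕ → Fin K → Measure ℝ) :
    (T : ℕ) → Measure (History K T)
  | 0 => Measure.dirac Fin.elim0
  | T + 1 => (historyLaw π ν T ⊗ₘ stepKernel π ν T).map append

theorem isProbabilityMeasure_historyLaw {K : ℕ} (π : Algorithm K) (ν : ℕ → Fin K → Measure ℝ)
    (hν : ∀ n a, IsProbabilityMeasure (ν n a)) (T : ℕ) :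
    IsProbabilityMeasure (historyLaw π ν T) := by
  induction T with
  | zero => rw [historyLaw]; infer_instance
  | succ T ih =>
    have : IsMarkovKernel (obsKernel (ν T)) := ⟨fun a => hν T a⟩
    have : IsMarkovKernel (stepKernel π ν T) := by unfold stepKernel; infer_instance
    rw [historyLaw]
    exact Measure.isProbabilityMeasure_map measurable_append.aemeasurable

/-- The number `N_a(T)` of pulls of arm `a` in a history of length `T`. -/
def numPulls {K T : ℕ} (a : Fin K) (h : History K T) : ℕ :=
  (Finset.univ.filter fun i => (h i).1 = a).card

/-- The expectation of `N_a(T)` when the instance `μ` is corrupted in round `n` by `H n`. -/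
def expectedPulls {K : ℕ} (ε : ℝ) (π : Algorithm K) (μ : Fin K → ProbabilityMeasure ℝ)
    (H : ℕ → Fin K → ProbabilityMeasure ℝ) (a : Fin K) (T : ℕ) : ℝ≥0∞ :=
  ∫⁻ h, (numPulls a h : ℝ≥0∞) ∂historyLaw π (fun n b => corrupt ε (μ b) (H n b)) T

/-- Uniformly good on a class `I` of instances: for every instance of the class and every
suboptimal arm, the expected number of pulls is `o(T ^ α)` for all `α > 0`, uniformly over all
time-varying corruptions. -/
def UniformlyGoodOn {K : ℕ} (ε : ℝ) (I : Set (Fin K → ProbabilityMeasure ℝ))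
    (π : Algorithm K) : Prop :=
  ∀ μ ∈ I, ∀ a, mean (μ a) < bestMean μ → ∀ α : ℝ, 0 < α →
    Tendsto (fun T : ℕ =>
      (⨆ H : ℕ → Fin K → ProbabilityMeasure ℝ, expectedPulls ε π μ H a T) /
        ENNReal.ofReal ((T : ℝ) ^ α)) atTop (𝓝 0)

/-- Uniformly good for the family `L` of arm laws. -/
def UniformlyGood {K : ℕ} (ε : ℝ) (L : Set (ProbabilityMeasure ℝ)) (π : Algorithm K) : Prop :=
  UniformlyGoodOn ε (instances K L) π

/-- `liminf_T (1 / log T) sup_H E[N_a(T)]`, the corruptions `H` being constant in time. -/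
def pullRate {K : ℕ} (ε : ℝ) (π : Algorithm K) (μ : Fin K → ProbabilityMeasure ℝ)
    (a : Fin K) : ℝ≥0∞ :=
  liminf (fun T : ℕ =>
    (⨆ H : Fin K → ProbabilityMeasure ℝ, expectedPulls ε π μ (fun _ => H) a T) /
      ENNReal.ofReal (Real.log T)) atTop

/-- The divergence `KL(N(x,1) ⊙_ε H, N(y,1) ⊙_ε H')`. -/
def corruptKL (ε x y : ℝ) (H H' : ProbabilityMeasure ℝ) : ℝ≥0∞ :=
  InformationTheory.klDiv (corrupt ε (gaussian x) H) (corrupt ε (gaussian y) H')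

/-- The corrupted Gaussian divergence `kl^ε_G(x, y)`. -/
def klG (ε x y : ℝ) : ℝ≥0∞ :=
  ⨅ (H : ProbabilityMeasure ℝ) (H' : ProbabilityMeasure ℝ), corruptKL ε x y H H'

/-- `(H₁, H₂)` is the pair of corruption laws given, for some normalising constants with
`c₂ ≤ 1 / c₁`, by
`d(η ⊙_ε H₁) = (1 - ε) dη` where `dη/dκ ≥ c₁`, and `c₁ (1 - ε) dκ` elsewhere;
`d(κ ⊙_ε H₂) = (1 - ε) dκ` where `dη/dκ ≤ 1 / c₂`, and `c₂ (1 - ε) dη` elsewhere;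
here `η = N(x,1)`, `κ = N(y,1)`, and `dη/dκ` is the quotient of the Gaussian densities. -/
def IsHuberPair (ε x y : ℝ) (H₁ H₂ : ProbabilityMeasure ℝ) : Prop :=
  ∃ c₁ c₂ : ℝ≥0, c₁ * c₂ ≤ 1 ∧
    corrupt ε (gaussian x) H₁ =
      (1 - ε).toNNReal •
        ((gaussianReal x 1).restrict {t | c₁ * gaussianPDFReal y 1 t ≤ gaussianPDFReal x 1 t} +
          c₁ • (gaussianReal y 1).restrict
            {t | c₁ * gaussianPDFReal y 1 t ≤ gaussianPDFReal x 1 t}ᶜ) ∧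
    corrupt ε (gaussian y) H₂ =
      (1 - ε).toNNReal •
        ((gaussianReal y 1).restrict {t | c₂ * gaussianPDFReal x 1 t ≤ gaussianPDFReal y 1 t} +
          c₂ • (gaussianReal x 1).restrict
            {t | c₂ * gaussianPDFReal x 1 t ≤ gaussianPDFReal y 1 t}ᶜ)

end

end CorruptedBandit

open CorruptedBandit

/-!
The lower bound is a change-of-measure argument, and the optimality of Huber's pair is convex
duality; both rest on one variational inequality,
`KL(P, Q) ≥ ∫ φ dP + 1 - ∫ exp φ dQ` for bounded `φ` (`ofReal_integral_sub_le_klDiv`).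

*Huber's pair.* The two corrupted laws of a Huber pair are `(1 - ε) max(dη, c₁ dκ)` and
`(1 - ε) max(dκ, c₂ dη)`. As `c₁ c₂ ≤ 1`, their likelihood ratio `r` is `dη/dκ` clipped to the
interval `[c₁, 1/c₂]`. The first corruption sits where `r = c₁` is minimal, the second where
`r = 1/c₂` is maximal, so the choice `φ = log r` in the variational inequality bounds the divergence
of every other pair of corrupted laws from below by that of the Huber pair
(`klDiv_corrupt_le_of_saddle`, `IsHuberPair.corruptKL_le`). The intermediate value theorem yields
constants that make both measures probability measures. If one of them is at least `1`, then
`(1 - ε) max(dη, dκ)` has mass at most one, the corruptions can make the two laws equal, and the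
divergence is `0` (`exists_common_law`); otherwise they form a Huber pair. In either case the
infimum is attained, by corrupted laws dominated by Gaussian ones.

*Lower bound.* Let `m` be the largest mean of the instance, and replace arm `a` by `N(y,1)` with `y`
slightly above `m`. The laws of the history in the two environments differ through the observations
from `a` only, so their divergence is at most the expected number of pulls of `a` times the
divergence `D` of the two observed laws of `a` (`klDiv_historyLaw_le`). In the first environment `a`
is rarely pulled, in the second one every other arm is; the variational inequality for a multiple of
the indicator of "`a` has at most half of the pulls" shows that the divergence of the histories is
at least `(1 - o(1)) log T` (`eventually_mul_log_le_klDiv`). Hence the rate is at least `1 / D`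
(`one_div_klDiv_le_pullRate`). This covers `D = 0` as well, where it says that the hypotheses are
contradictory. Finally `y` decreases to `m` while the corruptions are kept fixed at an optimal pair
for the mean `m`: the log-density between the two corrupted laws of mean `m` and `y` is at most
`(y - m)` times an affine function of `|t|`, which is integrable, so `D` exceeds the optimal value by
`O(y - m)` (`exists_forall_corruptKL_le`).
-/

namespace CorruptedBandit

/-! ### Kullback–Leibler divergence -/

section KullbackLeibler

open InformationTheory Real

variable {α : Type*} {mα : MeasurableSpace α}

/-- The variational lower bound on the Kullback–Leibler divergence: the convex conjugate of
`t ↦ t * log t + 1 - t` is `s ↦ exp s - 1`. -/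
theorem ofReal_integral_sub_le_klDiv (P Q : Measure α) [IsProbabilityMeasure P]
    [IsProbabilityMeasure Q] {φ : α → ℝ} (hφ : Measurable φ) {C : ℝ} (hC : ∀ t, |φ t| ≤ C) :
    ENNReal.ofReal (∫ t, φ t ∂P + 1 - ∫ t, exp (φ t) ∂Q) ≤ klDiv P Q := by
  by_cases hfin : klDiv P Q = ∞
  · simp [hfin]
  obtain ⟨hac, hint⟩ := klDiv_ne_top_iff.1 hfin
  have hφP : Integrable φ P :=
    Integrable.of_bound hφ.aestronglyMeasurable C (ae_of_all _ fun t => by simpa using hC t)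
  have heQ : Integrable (fun t => exp (φ t)) Q := by
    refine Integrable.of_bound (by fun_prop) (exp C) (ae_of_all _ fun t => ?_)
    rw [Real.norm_eq_abs, abs_of_pos (exp_pos _)]
    exact exp_le_exp.2 ((le_abs_self _).trans (hC t))
  have hpos : 0 < ∫ t, exp (φ t) ∂Q := integral_exp_pos heQ
  have : IsProbabilityMeasure (Q.tilted φ) := isProbabilityMeasure_tilted heQ
  have hac' : P ≪ Q.tilted φ := hac.trans (absolutelyContinuous_tilted heQ)
  have hnn := integral_llr_add_sub_measure_univ_nonneg hac'
    (integrable_llr_tilted_right hac hφP hint heQ)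
  rw [integral_llr_tilted_right hac hφP heQ hint] at hnn
  rw [klDiv_of_ac_of_integrable hac hint]
  refine ENNReal.ofReal_le_ofReal ?_
  have hlog := Real.log_le_sub_one_of_pos hpos
  simp only [probReal_univ] at hnn ⊢
  linarith

/-- For a density bounded away from `0` and `∞` the divergence is the plain integral of its
logarithm. -/
theorem klDiv_withDensity_ofReal (P Q : Measure α) [IsProbabilityMeasure P]
    [IsProbabilityMeasure Q] {r : α → ℝ} (hr : Measurable r) {lo hi : ℝ} (hlo : 0 < lo)
    (hl : ∀ t, lo ≤ r t) (hh : ∀ t, r t ≤ hi)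
    (hP : P = Q.withDensity fun t => ENNReal.ofReal (r t)) :
    klDiv P Q = ENNReal.ofReal (∫ t, log (r t) ∂P) := by
  have hac : P ≪ Q := hP ▸ withDensity_absolutelyContinuous _ _
  have hrn : P.rnDeriv Q =ᵐ[P] fun t => ENNReal.ofReal (r t) := by
    refine hac.ae_le ?_
    rw [hP]
    exact Measure.rnDeriv_withDensity Q (by fun_prop)
  have hllr : llr P Q =ᵐ[P] fun t => log (r t) := by
    filter_upwards [hrn] with t ht
    rw [llr, ht, ENNReal.toReal_ofReal (hlo.le.trans (hl t))]
  have hint : Integrable (fun t => log (r t)) P := by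
    refine Integrable.of_bound hr.log.aestronglyMeasurable (max |log lo| |log hi|)
      (ae_of_all _ fun t => ?_)
    exact abs_le_max_abs_abs (log_le_log hlo (hl t)) (log_le_log (hlo.trans_le (hl t)) (hh t))
  rw [klDiv_of_ac_of_integrable hac ((integrable_congr hllr).2 hint), integral_congr_ae hllr]
  simp

theorem rnDeriv_le_of_le_withDensity {Q Q' : Measure α} [IsFiniteMeasure Q] [IsFiniteMeasure Q']
    {f : α → ℝ≥0∞} (h : Q ≤ Q'.withDensity f) :
    Q.rnDeriv Q' ≤ᵐ[Q'] f := by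
  have hac : Q ≪ Q' :=
    (Measure.absolutelyContinuous_of_le h).trans (withDensity_absolutelyContinuous _ _)
  refine ae_le_of_forall_setLIntegral_le_of_sigmaFinite (Measure.measurable_rnDeriv _ _)
    fun s hs _ => ?_
  rw [Measure.setLIntegral_rnDeriv hac, ← withDensity_apply _ hs]
  exact h s

/-- Replacing the second argument by a measure whose log-density with respect to it is at most `w`
in absolute value increases the divergence by at most `∫ w`. -/
theorem klDiv_le_klDiv_add_integral (P Q Q' : Measure α) [IsProbabilityMeasure P]
    [IsProbabilityMeasure Q] [IsProbabilityMeasure Q'] {w : α → ℝ}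
    (hwP : Integrable w P)
    (h1 : Q ≤ Q'.withDensity fun t => ENNReal.ofReal (exp (w t)))
    (h2 : Q' ≤ Q.withDensity fun t => ENNReal.ofReal (exp (w t))) :
    klDiv P Q' ≤ klDiv P Q + ENNReal.ofReal (∫ t, w t ∂P) := by
  by_cases hfin : klDiv P Q = ∞
  · simp [hfin]
  obtain ⟨hac, hint⟩ := klDiv_ne_top_iff.1 hfin
  have hQQ' : Q ≪ Q' :=
    (Measure.absolutelyContinuous_of_le h1).trans (withDensity_absolutelyContinuous _ _)
  have hQ'Q : Q' ≪ Q :=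
    (Measure.absolutelyContinuous_of_le h2).trans (withDensity_absolutelyContinuous _ _)
  have hac' := hac.trans hQQ'
  have hchain := hac'.ae_le (Measure.rnDeriv_mul_rnDeriv (κ := Q') hac)
  have hb1 := hac'.ae_le (rnDeriv_le_of_le_withDensity h1)
  have hb2 := hac.ae_le (rnDeriv_le_of_le_withDensity h2)
  have hinv := hac.ae_le (Measure.inv_rnDeriv hQQ')
  have hllr : ∀ᵐ t ∂P, |llr P Q' t - llr P Q t| ≤ w t := by
    filter_upwards [hchain, hb1, hb2, hinv, Measure.rnDeriv_pos hac,
      hac.ae_le (Measure.rnDeriv_lt_top P Q), hac.ae_le (Measure.rnDeriv_pos hQQ'),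
      hac'.ae_le (Measure.rnDeriv_lt_top Q Q')] with t hc hb1 hb2 hi hp hp' hq hq'
    have hp0 : 0 < (P.rnDeriv Q t).toReal := ENNReal.toReal_pos hp.ne' hp'.ne
    have hq0 : 0 < (Q.rnDeriv Q' t).toReal := ENNReal.toReal_pos hq.ne' hq'.ne
    have e : llr P Q' t - llr P Q t = log (Q.rnDeriv Q' t).toReal := by
      rw [llr, llr, ← hc, Pi.mul_apply, ENNReal.toReal_mul, log_mul hp0.ne' hq0.ne']
      ring
    have u : log (Q.rnDeriv Q' t).toReal ≤ w t := by
      rw [log_le_iff_le_exp hq0]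
      exact ENNReal.toReal_le_of_le_ofReal (exp_pos _).le hb1
    have l : -log (Q.rnDeriv Q' t).toReal ≤ w t := by
      rw [← log_inv, log_le_iff_le_exp (inv_pos.2 hq0), ← ENNReal.toReal_inv]
      refine ENNReal.toReal_le_of_le_ofReal (exp_pos _).le ?_
      have : (Q.rnDeriv Q' t)⁻¹ = Q'.rnDeriv Q t := hi
      rw [this]; exact hb2
    rw [e]
    exact abs_le.2 ⟨by linarith, u⟩
  have hdiff : Integrable (fun t => llr P Q' t - llr P Q t) P :=
    hwP.mono' ((measurable_llr _ _).sub (measurable_llr _ _)).aestronglyMeasurable hllr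
  have hint' : Integrable (llr P Q') P := by
    exact (hdiff.add hint).congr (ae_of_all _ fun t => by simp)
  rw [klDiv_of_ac_of_integrable hac' hint', klDiv_of_ac_of_integrable hac hint]
  have hle : ∫ t, llr P Q' t ∂P ≤ ∫ t, llr P Q t ∂P + ∫ t, w t ∂P := by
    rw [← integral_add hint hwP]
    refine integral_mono_ae hint' (hint.add hwP) ?_
    filter_upwards [hllr] with t ht
    have := (abs_le.1 ht).2
    linarith
  simp only [probReal_univ, add_sub_cancel_right]
  exact (ENNReal.ofReal_le_ofReal hle).trans ENNReal.ofReal_add_le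

end KullbackLeibler

/-! ### Change of measure for bandit histories -/

section Histories

open InformationTheory

variable {K : ℕ}

instance isMarkovKernel_obsKernel (ν : Fin K → Measure ℝ) [h : ∀ b, IsProbabilityMeasure (ν b)] :
    IsMarkovKernel (obsKernel ν) := ⟨fun a => h a⟩

instance isMarkovKernel_stepKernel (π : Algorithm K) (ν : ℕ → Fin K → Measure ℝ)
    [∀ n b, IsProbabilityMeasure (ν n b)] (n : ℕ) : IsMarkovKernel (stepKernel π ν n) := by
  unfold stepKernel; infer_instance

theorem lintegral_stepKernel (π : Algorithm K) (ν : ℕ → Fin K → Measure ℝ)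
    [∀ n b, IsProbabilityMeasure (ν n b)] (n : ℕ) (h : History K n) {g : Fin K × ℝ → ℝ≥0∞}
    (hg : Measurable g) :
    ∫⁻ q, g q ∂stepKernel π ν n h =
      ∑ b, (∫⁻ t, g (b, t) ∂ν n b) * π.policy n h {b} := by
  rw [stepKernel, Kernel.lintegral_compProd _ _ _ hg, lintegral_fintype]
  rfl

/-- Changing the law of arm `a` alone multiplies the law of a round by the likelihood ratio of the
observation on the event that `a` is pulled. -/
theorem stepKernel_eq_withDensity (π : Algorithm K) {ν ν' : ℕ → Fin K → Measure ℝ}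
    [∀ n b, IsProbabilityMeasure (ν n b)] [∀ n b, IsProbabilityMeasure (ν' n b)] (n : ℕ)
    {a : Fin K} (hne : ∀ b ≠ a, ν n b = ν' n b) (hac : ν n a ≪ ν' n a) :
    stepKernel π ν n = (stepKernel π ν' n).withDensity
      fun _ q => if q.1 = a then (ν n a).rnDeriv (ν' n a) q.2 else 1 := by
  have hF : Measurable fun q : Fin K × ℝ =>
      if q.1 = a then (ν n a).rnDeriv (ν' n a) q.2 else 1 :=
    Measurable.ite (measurable_fst (measurableSet_singleton a))
      ((Measure.measurable_rnDeriv _ _).comp measurable_snd) measurable_const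
  have hF' : Measurable (Function.uncurry fun (_ : History K n) (q : Fin K × ℝ) =>
      if q.1 = a then (ν n a).rnDeriv (ν' n a) q.2 else 1) := hF.comp measurable_snd
  ext h : 1
  refine Measure.ext_of_lintegral _ fun g hg => ?_
  rw [Kernel.lintegral_withDensity _ hF' h hg, lintegral_stepKernel _ _ _ _ hg,
    lintegral_stepKernel _ _ _ _
      (g := fun q => (if q.1 = a then (ν n a).rnDeriv (ν' n a) q.2 else 1) * g q) (hF.mul hg)]
  refine Finset.sum_congr rfl fun b _ => ?_
  by_cases hb : b = a
  · subst hb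
    have hgb : Measurable fun t => g (b, t) := hg.comp measurable_prodMk_left
    simp only [if_true]
    rw [lintegral_rnDeriv_mul hac hgb.aemeasurable]
  · simp [hb, hne b hb]

theorem klDiv_compProd_stepKernel (π : Algorithm K) {ν ν' : ℕ → Fin K → Measure ℝ}
    [∀ n b, IsProbabilityMeasure (ν n b)] [∀ n b, IsProbabilityMeasure (ν' n b)] (n : ℕ)
    {a : Fin K} (hne : ∀ b ≠ a, ν n b = ν' n b) (hac : ν n a ≪ ν' n a)
    (L : Measure (History K n)) [IsProbabilityMeasure L] :
    klDiv (L ⊗ₘ stepKernel π ν n) (L ⊗ₘ stepKernel π ν' n) =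
      (∫⁻ h, π.policy n h {a} ∂L) * klDiv (ν n a) (ν' n a) := by
  set F : Fin K × ℝ → ℝ≥0∞ := fun q => if q.1 = a then (ν n a).rnDeriv (ν' n a) q.2 else 1
  have hF : Measurable F :=
    Measurable.ite (measurable_fst (measurableSet_singleton a))
      ((Measure.measurable_rnDeriv _ _).comp measurable_snd) measurable_const
  have hF' : Measurable (Function.uncurry fun (_ : History K n) (q : Fin K × ℝ) => F q) :=
    hF.comp measurable_snd
  have hF₂ : Measurable fun p : History K n × (Fin K × ℝ) => F p.2 := hF.comp measurable_snd
  have hstep := stepKernel_eq_withDensity π n hne hac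
  have : IsSFiniteKernel ((stepKernel π ν' n).withDensity fun _ q => F q) := by
    rw [← hstep]; infer_instance
  have hcomp : L ⊗ₘ stepKernel π ν n =
      (L ⊗ₘ stepKernel π ν' n).withDensity fun p => F p.2 := by
    rw [hstep, Measure.compProd_withDensity hF']
  have hrn := Measure.rnDeriv_withDensity (L ⊗ₘ stepKernel π ν' n) hF₂
  rw [klDiv_eq_lintegral_klFun_of_ac (hcomp ▸ withDensity_absolutelyContinuous _ _), hcomp,
    lintegral_congr_ae (g := fun p => ENNReal.ofReal (klFun (F p.2).toReal))
      (by filter_upwards [hrn] with p hp; rw [hp]),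
    Measure.lintegral_compProd (f := fun p => ENNReal.ofReal (klFun (F p.2).toReal))
      (by fun_prop), klDiv_eq_lintegral_klFun_of_ac hac, ← lintegral_mul_const _
      (Kernel.measurable_coe _ (measurableSet_singleton a))]
  refine lintegral_congr fun h => ?_
  rw [lintegral_stepKernel _ _ _ _ (g := fun q => ENNReal.ofReal (klFun (F q).toReal))
    (by fun_prop), Finset.sum_eq_single a]
  · simp [F, mul_comm]
  · intro b _ hb
    simp [F, hb, klFun_one]
  · simp

theorem measurable_numPulls {T : ℕ} (a : Fin K) :
    Measurable fun h : History K T => (numPulls a h : ℝ≥0∞) := by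
  have : (fun h : History K T => (numPulls a h : ℝ≥0∞)) =
      fun h => ∑ i, if (h i).1 = a then 1 else 0 := by
    ext h; simp [numPulls]
  rw [this]
  refine Finset.measurable_sum _ fun i _ => Measurable.ite ?_ measurable_const measurable_const
  exact (measurable_fst.comp (measurable_pi_apply i)) (measurableSet_singleton a)

theorem numPulls_append {T : ℕ} (a : Fin K) (p : History K T × (Fin K × ℝ)) :
    numPulls a (append p) = numPulls a p.1 + if p.2.1 = a then 1 else 0 := by
  rw [numPulls, numPulls, Finset.card_filter, Finset.card_filter, Fin.sum_univ_castSucc]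
  simp only [append, Fin.snoc_castSucc, Fin.snoc_last]

theorem sum_numPulls {T : ℕ} (h : History K T) : ∑ a, numPulls a h = T := by
  simp only [numPulls]
  rw [← Finset.card_eq_sum_card_fiberwise (f := fun i => (h i).1) (t := Finset.univ) (by simp)]
  simp

theorem lintegral_numPulls_succ (π : Algorithm K) (ν : ℕ → Fin K → Measure ℝ)
    [hν : ∀ n b, IsProbabilityMeasure (ν n b)] (a : Fin K) (T : ℕ) :
    ∫⁻ h, (numPulls a h : ℝ≥0∞) ∂historyLaw π ν (T + 1) =
      ∫⁻ h, (numPulls a h : ℝ≥0∞) ∂historyLaw π ν T +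
        ∫⁻ h, π.policy T h {a} ∂historyLaw π ν T := by
  have := isProbabilityMeasure_historyLaw π ν hν T
  have hite : Measurable fun q : Fin K × ℝ => if q.1 = a then (1 : ℝ≥0∞) else 0 :=
    Measurable.ite (measurable_fst (measurableSet_singleton a)) measurable_const measurable_const
  rw [historyLaw, lintegral_map (measurable_numPulls a) measurable_append]
  simp only [numPulls_append, Nat.cast_add, Nat.cast_ite, Nat.cast_one, Nat.cast_zero]
  have hpull : Measurable fun p : History K T × (Fin K × ℝ) => (numPulls a p.1 : ℝ≥0∞) :=
    (measurable_numPulls a).comp measurable_fst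
  have hnew : Measurable fun p : History K T × (Fin K × ℝ) =>
      if p.2.1 = a then (1 : ℝ≥0∞) else 0 := hite.comp measurable_snd
  rw [lintegral_add_left hpull, Measure.lintegral_compProd hpull,
    Measure.lintegral_compProd hnew]
  congr 1
  · simp
  · refine lintegral_congr fun h => ?_
    rw [lintegral_stepKernel _ _ _ _ hite, Finset.sum_eq_single a]
    · simp
    · intro b _ hb
      simp [hb]
    · simp

/-- The divergence decomposition, as an inequality: two environments that differ in arm `a` only
are told apart by the pulls of `a` only. -/
theorem klDiv_historyLaw_le (π : Algorithm K) {P Q : Fin K → Measure ℝ}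
    [hP : ∀ b, IsProbabilityMeasure (P b)] [hQ : ∀ b, IsProbabilityMeasure (Q b)]
    {a : Fin K} (hne : ∀ b ≠ a, P b = Q b) (hac : P a ≪ Q a) (T : ℕ) :
    klDiv (historyLaw π (fun _ => P) T) (historyLaw π (fun _ => Q) T) ≤
      (∫⁻ h, (numPulls a h : ℝ≥0∞) ∂historyLaw π (fun _ => P) T) * klDiv (P a) (Q a) := by
  induction T with
  | zero => simp [historyLaw]
  | succ T ih =>
    have := isProbabilityMeasure_historyLaw π (fun _ => P) (fun _ => hP) T
    have := isProbabilityMeasure_historyLaw π (fun _ => Q) (fun _ => hQ) T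
    rw [lintegral_numPulls_succ, add_mul,
      ← klDiv_compProd_stepKernel π (ν := fun _ => P) (ν' := fun _ => Q) T hne hac]
    calc _ ≤ klDiv (historyLaw π (fun _ => P) T ⊗ₘ stepKernel π (fun _ => P) T)
          (historyLaw π (fun _ => Q) T ⊗ₘ stepKernel π (fun _ => Q) T) := by
          rw [historyLaw, historyLaw]
          exact klDiv_map_le _ _ measurable_append
      _ ≤ _ := by
          rw [klDiv_compProd_eq_add]
          gcongr

end Histories

/-! ### Logarithmic lower bound on the number of pulls -/

section LowerBound

open InformationTheory

variable {K : ℕ}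

/-- Distinguishing two laws by an event: the variational bound for `l` times its indicator. -/
theorem ofReal_mul_sub_exp_mul_le_klDiv {α : Type*} {mα : MeasurableSpace α} (P Q : Measure α)
    [IsProbabilityMeasure P] [IsProbabilityMeasure Q] {E : Set α} (hE : MeasurableSet E) (l : ℝ) :
    ENNReal.ofReal (l * P.real E - Real.exp l * Q.real E) ≤ klDiv P Q := by
  have hφ : Measurable (E.indicator fun _ => l) := measurable_const.indicator hE
  refine le_trans (ENNReal.ofReal_le_ofReal ?_)
    (ofReal_integral_sub_le_klDiv P Q hφ (C := |l|) fun t => ?_)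
  · have h1 : ∫ t, E.indicator (fun _ => l) t ∂P = l * P.real E := by
      rw [integral_indicator_const _ hE, smul_eq_mul, mul_comm]
    have h2 : ∫ t, Real.exp (E.indicator (fun _ => l) t) ∂Q ≤ 1 + Real.exp l * Q.real E := by
      have hint : Integrable (fun t => 1 + E.indicator (fun _ => Real.exp l) t) Q :=
        (integrable_const 1).add ((integrable_const _).indicator hE)
      calc ∫ t, Real.exp (E.indicator (fun _ => l) t) ∂Q
          ≤ ∫ t, (1 + E.indicator (fun _ => Real.exp l) t) ∂Q := by
            refine integral_mono_of_nonneg (ae_of_all _ fun t => (Real.exp_pos _).le) hint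
              (ae_of_all _ fun t => ?_)
            by_cases ht : t ∈ E <;> simp [ht]
        _ = 1 + Real.exp l * Q.real E := by
            rw [integral_add (integrable_const 1) ((integrable_const _).indicator hE),
              integral_indicator_const _ hE]
            simp [mul_comm]
    linarith
  · by_cases ht : t ∈ E <;> simp [ht]

theorem measurableSet_two_mul_numPulls_le {T : ℕ} (a : Fin K) :
    MeasurableSet {h : History K T | 2 * (numPulls a h : ℝ≥0∞) ≤ T} :=
  measurableSet_le ((measurable_numPulls a).const_mul 2) measurable_const

theorem measure_two_mul_numPulls_le_compl {T : ℕ} (hT : T ≠ 0) (a : Fin K)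
    (L : Measure (History K T)) :
    L {h | 2 * (numPulls a h : ℝ≥0∞) ≤ T}ᶜ ≤ 2 * ((∫⁻ h, (numPulls a h : ℝ≥0∞) ∂L) / T) := by
  rw [← mul_div_assoc, ← lintegral_const_mul _ (measurable_numPulls a)]
  refine (measure_mono fun h hh => ?_).trans (meas_ge_le_lintegral_div
    ((measurable_numPulls a).const_mul 2).aemeasurable (by simpa using hT) (by simp))
  have hlt : ¬ 2 * (numPulls a h : ℝ≥0∞) ≤ T := hh
  exact (not_le.1 hlt).le

/-- If `a` receives at most half of the pulls, the other arms receive at least half. -/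
theorem measure_two_mul_numPulls_le {T : ℕ} (hT : T ≠ 0) (a : Fin K) (L : Measure (History K T)) :
    L {h | 2 * (numPulls a h : ℝ≥0∞) ≤ T} ≤
      2 * ((∑ b ∈ Finset.univ.erase a, ∫⁻ h, (numPulls b h : ℝ≥0∞) ∂L) / T) := by
  have hm : Measurable fun h : History K T =>
      ∑ b ∈ Finset.univ.erase a, (numPulls b h : ℝ≥0∞) :=
    Finset.measurable_sum _ fun b _ => measurable_numPulls b
  rw [← mul_div_assoc, ← lintegral_finsetSum _ fun b _ => measurable_numPulls b,
    ← lintegral_const_mul _ hm]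
  refine (measure_mono fun h hh => ?_).trans (meas_ge_le_lintegral_div
    (hm.const_mul 2).aemeasurable (by simpa using hT) (by simp))
  have hsum := sum_numPulls h
  rw [← Finset.add_sum_erase _ _ (Finset.mem_univ a)] at hsum
  have hh' : 2 * numPulls a h ≤ T := by
    have : 2 * (numPulls a h : ℝ≥0∞) ≤ T := hh
    exact_mod_cast this
  have : T ≤ 2 * ∑ b ∈ Finset.univ.erase a, numPulls b h := by omega
  show (T : ℝ≥0∞) ≤ 2 * ∑ b ∈ Finset.univ.erase a, (numPulls b h : ℝ≥0∞)
  exact_mod_cast this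

/-- If, in one environment, the pulls of `a` are `o(T)` and, in a second one, those of every other
arm are `o(T ^ α)` for all `α > 0`, then the divergence between the two laws of the history is
asymptotically at least `log T`. -/
theorem eventually_mul_log_le_klDiv (a : Fin K) (L L' : (T : ℕ) → Measure (History K T))
    [∀ T, IsProbabilityMeasure (L T)] [∀ T, IsProbabilityMeasure (L' T)]
    (h1 : Tendsto (fun T : ℕ => (∫⁻ h, (numPulls a h : ℝ≥0∞) ∂L T) / T) atTop (𝓝 0))
    (h2 : ∀ b ≠ a, ∀ α : ℝ, 0 < α → Tendsto (fun T : ℕ =>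
      (∫⁻ h, (numPulls b h : ℝ≥0∞) ∂L' T) / ENNReal.ofReal ((T : ℝ) ^ α)) atTop (𝓝 0))
    {δ : ℝ} (hδ : 0 < δ) (hδ1 : δ < 1) :
    ∀ᶠ T : ℕ in atTop,
      ENNReal.ofReal ((1 - 3 * δ) * Real.log T) ≤ klDiv (L T) (L' T) := by
  have hδ' : (0 : ℝ≥0∞) < ENNReal.ofReal δ := ENNReal.ofReal_pos.2 hδ
  have t1 : Tendsto (fun T : ℕ => 2 * ((∫⁻ h, (numPulls a h : ℝ≥0∞) ∂L T) / T)) atTop (𝓝 0) := by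
    simpa using ENNReal.Tendsto.const_mul h1 (Or.inr (by simp : (2 : ℝ≥0∞) ≠ ∞))
  have t2 : Tendsto (fun T : ℕ => 2 * ∑ b ∈ Finset.univ.erase a,
      (∫⁻ h, (numPulls b h : ℝ≥0∞) ∂L' T) / ENNReal.ofReal ((T : ℝ) ^ δ)) atTop (𝓝 0) := by
    have := tendsto_finsetSum (Finset.univ.erase a) fun b hb =>
      h2 b (Finset.ne_of_mem_erase hb) δ hδ
    simpa using ENNReal.Tendsto.const_mul this (Or.inr (by simp : (2 : ℝ≥0∞) ≠ ∞))
  have hlog : ∀ᶠ T : ℕ in atTop, 1 ≤ Real.log T :=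
    (Real.tendsto_log_atTop.comp tendsto_natCast_atTop_atTop).eventually_ge_atTop 1
  filter_upwards [t1.eventually_le_const hδ', t2.eventually_le_const hδ', hlog,
    eventually_ne_atTop 0] with T ht1 ht2 hlog hT
  set E : Set (History K T) := {h | 2 * (numPulls a h : ℝ≥0∞) ≤ T}
  have hE : MeasurableSet E := measurableSet_two_mul_numPulls_le a
  have hTpos : (0 : ℝ) < T := by positivity
  have hLE : 1 - δ ≤ (L T).real E := by
    have : (L T).real Eᶜ ≤ δ :=
      ENNReal.toReal_le_of_le_ofReal hδ.le ((measure_two_mul_numPulls_le_compl hT a _).trans ht1)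
    rw [probReal_compl_eq_one_sub hE] at this
    linarith
  have hexp : Real.exp ((1 - δ) * Real.log T) = (T : ℝ) ^ (1 - δ) := by
    rw [Real.rpow_def_of_pos hTpos, mul_comm]
  have hL'E : (T : ℝ) ^ (1 - δ) * (L' T).real E ≤ δ := by
    have hpow : (T : ℝ) ^ (1 - δ) = T / (T : ℝ) ^ δ := by
      rw [Real.rpow_sub hTpos, Real.rpow_one]
    have hTδ : (0 : ℝ) < (T : ℝ) ^ δ := Real.rpow_pos_of_pos hTpos _
    have hle : (L' T) E ≤ ENNReal.ofReal (δ * ((T : ℝ) ^ δ / T)) := by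
      refine (measure_two_mul_numPulls_le hT a _).trans ?_
      have hsum : 2 * (∑ b ∈ Finset.univ.erase a, ∫⁻ h, (numPulls b h : ℝ≥0∞) ∂L' T) ≤
          ENNReal.ofReal δ * ENNReal.ofReal ((T : ℝ) ^ δ) := by
        rw [← ENNReal.div_le_iff_le_mul (Or.inl (ENNReal.ofReal_pos.2 hTδ).ne')
          (Or.inl ENNReal.ofReal_ne_top), mul_div_assoc]
        simpa only [div_eq_mul_inv, Finset.sum_mul] using ht2
      rw [← mul_div_assoc, ENNReal.ofReal_mul hδ.le, ENNReal.ofReal_div_of_pos hTpos,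
        ENNReal.ofReal_natCast, ← mul_div_assoc]
      gcongr
    have hle' : (L' T).real E ≤ δ * ((T : ℝ) ^ δ / T) :=
      ENNReal.toReal_le_of_le_ofReal (by positivity) hle
    calc (T : ℝ) ^ (1 - δ) * (L' T).real E ≤ T / (T : ℝ) ^ δ * (δ * ((T : ℝ) ^ δ / T)) := by
          rw [hpow]; gcongr
      _ = δ := by field_simp
  refine le_trans (ENNReal.ofReal_le_ofReal ?_)
    (ofReal_mul_sub_exp_mul_le_klDiv (L T) (L' T) hE ((1 - δ) * Real.log T))
  rw [hexp]
  -- the bound obtained is `(1 - δ)² log T - δ`, and `δ ≤ δ log T` as `log T ≥ 1`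
  have hmul : (1 - δ) * Real.log T * (1 - δ) ≤ (1 - δ) * Real.log T * (L T).real E :=
    mul_le_mul_of_nonneg_left hLE (mul_nonneg (by linarith) (by linarith))
  nlinarith [mul_nonneg (sq_nonneg δ) (zero_le_one.trans hlog)]

theorem ofReal_div_le_div_of_mul_le_mul {c l : ℝ} (hc : 0 < c) (hl : 0 < l) {E D : ℝ≥0∞}
    (h : ENNReal.ofReal (c * l) ≤ E * D) :
    ENNReal.ofReal c / D ≤ E / ENNReal.ofReal l := by
  by_cases hD : D = ∞
  · simp [hD]
  -- for `D = 0` the left side would be infinite, but then the hypothesis fails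
  have hD0 : D ≠ 0 := by
    rintro rfl
    rw [mul_zero] at h
    exact (ENNReal.ofReal_pos.2 (mul_pos hc hl)).not_ge h
  rw [ENNReal.div_le_iff hD0 hD, ENNReal.mul_comm_div, ← mul_div_assoc,
    ENNReal.le_div_iff_mul_le (Or.inl (ENNReal.ofReal_pos.2 hl).ne')
      (Or.inl ENNReal.ofReal_ne_top), ← ENNReal.ofReal_mul hc.le]
  exact h

/-- The asymptotic lower bound for a single pair of observed laws of arm `a`: the algorithm has to
tell `μ`, where `a` is pulled rarely, from the instance with `μ a` replaced by `P'`, where all other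
arms are pulled rarely. -/
theorem one_div_klDiv_le_pullRate {ε : ℝ} (h0 : 0 ≤ ε) (h1 : ε ≤ 1) (π : Algorithm K)
    (μ : Fin K → ProbabilityMeasure ℝ) (a : Fin K) (P' H H' : ProbabilityMeasure ℝ)
    (hμ : ∀ α : ℝ, 0 < α → Tendsto (fun T : ℕ =>
      (⨆ H : ℕ → Fin K → ProbabilityMeasure ℝ, expectedPulls ε π μ H a T) /
        ENNReal.ofReal ((T : ℝ) ^ α)) atTop (𝓝 0))
    (hμ' : ∀ b ≠ a, ∀ α : ℝ, 0 < α → Tendsto (fun T : ℕ =>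
      (⨆ H : ℕ → Fin K → ProbabilityMeasure ℝ,
          expectedPulls ε π (Function.update μ a P') H b T) /
        ENNReal.ofReal ((T : ℝ) ^ α)) atTop (𝓝 0)) :
    1 / klDiv (corrupt ε (μ a) H) (corrupt ε P' H') ≤ pullRate ε π μ a := by
  by_cases hD : klDiv (corrupt ε (μ a) H) (corrupt ε P' H') = ∞
  · simp [hD]
  set D := klDiv (corrupt ε (μ a) H) (corrupt ε P' H') with hDdef
  set P : Fin K → Measure ℝ := fun b => corrupt ε (μ b) H with hPdef
  -- only the corruption of arm `a` matters, that of the others has to agree in both environments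
  set G : Fin K → ProbabilityMeasure ℝ := Function.update (fun _ => H) a H' with hGdef
  set Q : Fin K → Measure ℝ := fun b => corrupt ε (Function.update μ a P' b) (G b) with hQdef
  have hPprob : ∀ b, IsProbabilityMeasure (P b) := fun b => isProbabilityMeasure_corrupt h0 h1 _ _
  have hQprob : ∀ b, IsProbabilityMeasure (Q b) := fun b => isProbabilityMeasure_corrupt h0 h1 _ _
  have hPL := fun T => isProbabilityMeasure_historyLaw π (fun _ => P) (fun _ => hPprob) T
  have hQL := fun T => isProbabilityMeasure_historyLaw π (fun _ => Q) (fun _ => hQprob) T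
  have hne : ∀ b ≠ a, P b = Q b := fun b hb => by simp [hPdef, hQdef, hGdef, hb]
  have hQa : Q a = corrupt ε P' H' := by simp [hQdef, hGdef]
  have hac : P a ≪ Q a := by
    rw [hQa]; exact (klDiv_ne_top_iff.1 hD).1
  have key : ∀ δ ∈ Set.Ioo (0 : ℝ) (1 / 3),
      ENNReal.ofReal (1 - 3 * δ) / D ≤ pullRate ε π μ a := by
    intro δ hδ
    refine le_liminf_of_le (by isBoundedDefault) ?_
    have hev := eventually_mul_log_le_klDiv a (fun T => historyLaw π (fun _ => P) T)
      (fun T => historyLaw π (fun _ => Q) T) ?_ ?_ hδ.1 (hδ.2.trans (by norm_num))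
    · have hlogpos : ∀ᶠ T : ℕ in atTop, 0 < Real.log T :=
        (Real.tendsto_log_atTop.comp tendsto_natCast_atTop_atTop).eventually_gt_atTop 0
      filter_upwards [hev, hlogpos] with T hT hlog
      have hle := ofReal_div_le_div_of_mul_le_mul (by linarith [hδ.2]) hlog
        (hT.trans (klDiv_historyLaw_le π hne hac T))
      rw [hQa] at hle
      refine hle.trans ?_
      gcongr
      exact le_iSup (fun H : Fin K → ProbabilityMeasure ℝ =>
        expectedPulls ε π μ (fun _ => H) a T) fun _ => H
    · refine tendsto_of_tendsto_of_tendsto_of_le_of_le tendsto_const_nhds (hμ 1 one_pos)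
        (fun _ => zero_le) fun T => ?_
      simp only [Real.rpow_one, ENNReal.ofReal_natCast]
      gcongr
      exact le_iSup (fun H : ℕ → Fin K → ProbabilityMeasure ℝ => expectedPulls ε π μ H a T)
        fun _ _ => H
    · intro b hb α hα
      refine tendsto_of_tendsto_of_tendsto_of_le_of_le tendsto_const_nhds (hμ' b hb α hα)
        (fun _ => zero_le) fun T => ?_
      simp only
      gcongr
      exact le_iSup (fun H : ℕ → Fin K → ProbabilityMeasure ℝ =>
        expectedPulls ε π (Function.update μ a P') H b T) fun _ => G
  have hlim : Tendsto (fun δ : ℝ => ENNReal.ofReal (1 - 3 * δ) / D) (𝓝[>] 0) (𝓝 (1 / D)) := by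
    refine ENNReal.Tendsto.div_const ?_ (Or.inl one_ne_zero)
    have : Tendsto (fun δ : ℝ => ENNReal.ofReal (1 - 3 * δ)) (𝓝 0)
        (𝓝 (ENNReal.ofReal (1 - 3 * 0))) :=
      (ENNReal.continuous_ofReal.comp (by fun_prop : Continuous fun δ : ℝ => 1 - 3 * δ)).tendsto 0
    simpa using this.mono_left nhdsWithin_le_nhds
  refine le_of_tendsto hlim ?_
  filter_upwards [Ioo_mem_nhdsGT (by norm_num : (0 : ℝ) < 1 / 3)] with δ hδ using key δ hδ

end LowerBound

/-! ### Huber's least favourable pair -/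

section Huber

open InformationTheory Real

/-- Every probability measure above `(1 - ε) P` is a corrupted version of `P`. -/
theorem exists_corrupt_eq {ε : ℝ} (h0 : 0 < ε) (h1 : ε ≤ 1) (P : ProbabilityMeasure ℝ)
    {M : Measure ℝ} [IsProbabilityMeasure M] (hM : (1 - ε).toNNReal • (P : Measure ℝ) ≤ M) :
    ∃ H : ProbabilityMeasure ℝ, corrupt ε P H = M := by
  have hsum : (1 - ε).toNNReal + ε.toNNReal = 1 := by
    rw [← Real.toNNReal_add (by linarith) h0.le]; simp
  have hε : ε.toNNReal ≠ 0 := by simpa using h0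
  have hadd : M - (1 - ε).toNNReal • (P : Measure ℝ) + (1 - ε).toNNReal • (P : Measure ℝ) = M :=
    Measure.sub_add_cancel_of_le hM
  have hmass : (M - (1 - ε).toNNReal • (P : Measure ℝ)) Set.univ = ε.toNNReal := by
    have h := congrArg (fun m : Measure ℝ => m Set.univ) hadd
    simp only [Measure.add_apply, Measure.smul_apply, measure_univ, ENNReal.smul_def, smul_eq_mul,
      mul_one] at h
    have h' : ((1 - ε).toNNReal : ℝ≥0∞) + ε.toNNReal = 1 := by exact_mod_cast hsum
    rw [← h', add_comm] at h
    exact (ENNReal.add_right_inj ENNReal.coe_ne_top).1 h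
  refine ⟨⟨ε.toNNReal⁻¹ • (M - (1 - ε).toNNReal • (P : Measure ℝ)), ⟨?_⟩⟩, ?_⟩
  · rw [Measure.smul_apply, hmass, ENNReal.smul_def, smul_eq_mul, ← ENNReal.coe_mul,
      inv_mul_cancel₀ hε, ENNReal.coe_one]
  · unfold corrupt
    rw [ProbabilityMeasure.coe_mk, smul_smul, mul_inv_cancel₀ hε, one_smul, add_comm, hadd]

/-- The corruption puts no mass where the corrupted law already agrees with the uncorrupted part. -/
theorem measure_eq_zero_of_corrupt_apply_eq {ε : ℝ} (h0 : 0 < ε) {P H : ProbabilityMeasure ℝ}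
    {s : Set ℝ} (hs : corrupt ε P H s = (1 - ε).toNNReal * (P : Measure ℝ) s) :
    (H : Measure ℝ) s = 0 := by
  rw [corrupt, Measure.add_apply, Measure.smul_apply, Measure.smul_apply, ENNReal.smul_def,
    ENNReal.smul_def, smul_eq_mul, smul_eq_mul] at hs
  have h : (ε.toNNReal : ℝ≥0∞) * (H : Measure ℝ) s = 0 := by
    refine (ENNReal.add_right_inj (a := (1 - ε).toNNReal * (P : Measure ℝ) s) ?_).1
      (by rw [hs, add_zero])
    exact ENNReal.mul_ne_top ENNReal.coe_ne_top (measure_ne_top _ _)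
  simpa [h0.not_ge] using h

theorem integral_corrupt {ε : ℝ} (h0 : 0 ≤ ε) (h1 : ε ≤ 1) {P H : ProbabilityMeasure ℝ} {f : ℝ → ℝ}
    (hP : Integrable f P) (hH : Integrable f H) :
    ∫ t, f t ∂corrupt ε P H =
      (1 - ε) * ∫ t, f t ∂(P : Measure ℝ) + ε * ∫ t, f t ∂(H : Measure ℝ) := by
  rw [corrupt, integral_add_measure (hP.smul_measure_nnreal) (hH.smul_measure_nnreal),
    integral_smul_nnreal_measure, integral_smul_nnreal_measure]
  simp [NNReal.smul_def, h0, h1]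

/-- A saddle point criterion: the likelihood ratio `r` of the two corrupted laws is bounded, and the
corruption of the first law sits where `r` is minimal, that of the second where `r` is maximal. Then
`log r` is an optimal dual variable for every other corruption. -/
theorem klDiv_corrupt_le_of_saddle {ε : ℝ} (h0 : 0 ≤ ε) (h1 : ε ≤ 1)
    {P Q H H' : ProbabilityMeasure ℝ} {r : ℝ → ℝ} (hr : Measurable r) {lo hi : ℝ} (hlo : 0 < lo)
    (hl : ∀ t, lo ≤ r t) (hh : ∀ t, r t ≤ hi)
    (hPQ : corrupt ε P H = (corrupt ε Q H').withDensity fun t => ENNReal.ofReal (r t))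
    (hH : ∀ᵐ t ∂(H : Measure ℝ), r t = lo) (hH' : ∀ᵐ t ∂(H' : Measure ℝ), r t = hi)
    (J J' : ProbabilityMeasure ℝ) :
    klDiv (corrupt ε P H) (corrupt ε Q H') ≤ klDiv (corrupt ε P J) (corrupt ε Q J') := by
  have hprob := fun P H => isProbabilityMeasure_corrupt h0 h1 P H
  have hrpos : ∀ t, 0 < r t := fun t => hlo.trans_le (hl t)
  have hlogbd : ∀ t, |log (r t)| ≤ max |log lo| |log hi| := fun t =>
    abs_le_max_abs_abs (log_le_log hlo (hl t)) (log_le_log (hrpos t) (hh t))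
  have hlogint : ∀ R : ProbabilityMeasure ℝ, Integrable (fun t => log (r t)) R := fun R =>
    Integrable.of_bound hr.log.aestronglyMeasurable _ (ae_of_all _ hlogbd)
  have hrint : ∀ (R : Measure ℝ) [IsProbabilityMeasure R], Integrable r R := fun R _ =>
    Integrable.of_bound hr.aestronglyMeasurable hi
      (ae_of_all _ fun t => by rw [norm_of_nonneg (hrpos t).le]; exact hh t)
  rw [klDiv_withDensity_ofReal _ _ hr hlo hl hh hPQ]
  refine le_trans (ENNReal.ofReal_le_ofReal ?_)
    (ofReal_integral_sub_le_klDiv _ _ hr.log hlogbd)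
  have hone : ∫ t, r t ∂corrupt ε Q H' = 1 := by
    have h := congrArg (fun m : Measure ℝ => m Set.univ) hPQ
    simp only [measure_univ, withDensity_apply _ MeasurableSet.univ, Measure.restrict_univ] at h
    rw [integral_eq_lintegral_of_nonneg_ae (ae_of_all _ fun t => (hrpos t).le)
      hr.aestronglyMeasurable, ← h, ENNReal.toReal_one]
  have e1 : ∫ t, log (r t) ∂(H : Measure ℝ) ≤ ∫ t, log (r t) ∂(J : Measure ℝ) := by
    refine integral_congr_ae (hH.mono fun t ht => congrArg log ht) |>.trans_le ?_
    calc _ = ∫ _, log lo ∂(J : Measure ℝ) := by simp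
      _ ≤ _ := integral_mono (integrable_const _) (hlogint J) fun t => log_le_log hlo (hl t)
  have e2 : ∫ t, r t ∂(J' : Measure ℝ) ≤ ∫ t, r t ∂(H' : Measure ℝ) := by
    refine le_of_le_of_eq ?_ (integral_congr_ae hH').symm
    calc _ ≤ ∫ _, hi ∂(J' : Measure ℝ) := integral_mono (hrint J') (integrable_const _) hh
      _ = _ := by simp
  simp only [exp_log (hrpos _)]
  rw [integral_corrupt h0 h1 (hrint Q) (hrint H')] at hone
  rw [integral_corrupt h0 h1 (hlogint P) (hlogint H),
    integral_corrupt h0 h1 (hlogint P) (hlogint J), integral_corrupt h0 h1 (hrint Q) (hrint J')]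
  nlinarith [mul_le_mul_of_nonneg_left e1 h0, mul_le_mul_of_nonneg_left e2 h0]

end Huber

section GaussianHuber

open InformationTheory

theorem nnreal_smul_measure_mono {α : Type*} {mα : MeasurableSpace α} {c d : ℝ≥0} (hcd : c ≤ d)
    {P Q : Measure α} (h : P ≤ Q) : c • P ≤ d • Q :=
  Measure.le_iff'.2 fun s => by
    rw [Measure.smul_apply, Measure.smul_apply, ENNReal.smul_def, ENNReal.smul_def]
    exact mul_le_mul' (ENNReal.coe_le_coe.2 hcd) (h s)

/-- The measure with density `max (dη, c dκ)` for `η = N(x,1)` and `κ = N(y,1)`. -/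
noncomputable def maxGaussian (c : ℝ≥0) (x y : ℝ) : Measure ℝ :=
  volume.withDensity fun t => max (gaussianPDF x 1 t) (c * gaussianPDF y 1 t)

theorem gaussianReal_eq_withDensity (x : ℝ) :
    gaussianReal x 1 = volume.withDensity (gaussianPDF x 1) :=
  gaussianReal_of_var_ne_zero x one_ne_zero

theorem smul_gaussianReal_eq_withDensity (c : ℝ≥0) (x : ℝ) :
    c • gaussianReal x 1 = volume.withDensity fun t => c * gaussianPDF x 1 t := by
  rw [gaussianReal_eq_withDensity, ← Measure.coe_nnreal_smul,
    ← withDensity_smul _ (measurable_gaussianPDF _ _)]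
  rfl

theorem gaussianReal_le_maxGaussian (c : ℝ≥0) (x y : ℝ) : gaussianReal x 1 ≤ maxGaussian c x y := by
  rw [gaussianReal_eq_withDensity]
  exact withDensity_mono (ae_of_all _ fun t => le_max_left _ _)

theorem smul_gaussianReal_le_maxGaussian (c : ℝ≥0) (x y : ℝ) :
    c • gaussianReal y 1 ≤ maxGaussian c x y := by
  rw [smul_gaussianReal_eq_withDensity]
  exact withDensity_mono (ae_of_all _ fun t => le_max_right _ _)

theorem maxGaussian_add_le (c d : ℝ≥0) (x y : ℝ) :
    maxGaussian (c + d) x y ≤ maxGaussian c x y + d • gaussianReal y 1 := by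
  rw [smul_gaussianReal_eq_withDensity, maxGaussian, maxGaussian,
    ← withDensity_add_left (by fun_prop)]
  refine withDensity_mono (ae_of_all _ fun t => ?_)
  simp only [Pi.add_apply, ENNReal.coe_add, add_mul]
  refine max_le ((le_max_left _ _).trans le_self_add) ?_
  gcongr
  exact le_max_right _ _

theorem maxGaussian_mono {c d : ℝ≥0} (h : c ≤ d) (x y : ℝ) :
    maxGaussian c x y ≤ maxGaussian d x y :=
  withDensity_mono (ae_of_all _ fun t => by dsimp only; gcongr)

theorem maxGaussian_zero (x y : ℝ) : maxGaussian 0 x y = gaussianReal x 1 := by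
  simp [maxGaussian, gaussianReal_eq_withDensity]

theorem maxGaussian_one_comm (x y : ℝ) : maxGaussian 1 x y = maxGaussian 1 y x := by
  simp [maxGaussian, max_comm]

theorem maxGaussian_le_add (c : ℝ≥0) (x y : ℝ) :
    maxGaussian c x y ≤ gaussianReal x 1 + c • gaussianReal y 1 := by
  simpa [maxGaussian_zero] using maxGaussian_add_le 0 c x y

instance isFiniteMeasure_maxGaussian (c : ℝ≥0) (x y : ℝ) : IsFiniteMeasure (maxGaussian c x y) :=
  isFiniteMeasure_of_le _ (maxGaussian_le_add c x y)

theorem measurableSet_mul_gaussianPDFReal_le (c : ℝ≥0) (x y : ℝ) :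
    MeasurableSet {t | c * gaussianPDFReal y 1 t ≤ gaussianPDFReal x 1 t} :=
  measurableSet_le (by fun_prop) (by fun_prop)

theorem coe_mul_gaussianPDF (c : ℝ≥0) (y t : ℝ) :
    c * gaussianPDF y 1 t = ENNReal.ofReal (c * gaussianPDFReal y 1 t) := by
  rw [ENNReal.ofReal_mul c.coe_nonneg, ENNReal.ofReal_coe_nnreal, gaussianPDF]

theorem restrict_add_smul_restrict_compl_eq (c : ℝ≥0) (x y : ℝ) :
    (gaussianReal x 1).restrict {t | c * gaussianPDFReal y 1 t ≤ gaussianPDFReal x 1 t} +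
        c • (gaussianReal y 1).restrict {t | c * gaussianPDFReal y 1 t ≤ gaussianPDFReal x 1 t}ᶜ =
      maxGaussian c x y := by
  have hS := measurableSet_mul_gaussianPDFReal_le c x y
  rw [← Measure.restrict_add_restrict_compl (μ := maxGaussian c x y) hS, ← Measure.restrict_smul,
    smul_gaussianReal_eq_withDensity, gaussianReal_eq_withDensity, maxGaussian,
    restrict_withDensity hS, restrict_withDensity hS.compl, restrict_withDensity hS,
    restrict_withDensity hS.compl]
  congr 1
  · refine withDensity_congr_ae ((ae_restrict_iff' hS).2 (ae_of_all _ fun t ht => ?_))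
    simp only [coe_mul_gaussianPDF]
    exact (max_eq_left (ENNReal.ofReal_le_ofReal ht)).symm
  · refine withDensity_congr_ae ((ae_restrict_iff' hS.compl).2 (ae_of_all _ fun t ht => ?_))
    simp only [coe_mul_gaussianPDF]
    have hlt : ¬ c * gaussianPDFReal y 1 t ≤ gaussianPDFReal x 1 t := ht
    exact (max_eq_right (ENNReal.ofReal_le_ofReal (not_le.1 hlt).le)).symm

/-- The corruption that turns `N(x,1)` into `(1 - ε) max (dη, c dκ)` sits on `{dη < c dκ}`. -/
theorem ae_lt_of_corrupt_eq {ε : ℝ} (h0 : 0 < ε) {x y : ℝ} {c : ℝ≥0} {H : ProbabilityMeasure ℝ}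
    (h : corrupt ε (gaussian x) H = (1 - ε).toNNReal • maxGaussian c x y) :
    ∀ᵐ t ∂(H : Measure ℝ), gaussianPDFReal x 1 t < c * gaussianPDFReal y 1 t := by
  have hz : (H : Measure ℝ) {t | c * gaussianPDFReal y 1 t ≤ gaussianPDFReal x 1 t} = 0 := by
    refine measure_eq_zero_of_corrupt_apply_eq h0 (P := gaussian x) ?_
    have hS := measurableSet_mul_gaussianPDFReal_le c x y
    rw [h, ← restrict_add_smul_restrict_compl_eq, Measure.smul_apply, Measure.add_apply,
      Measure.smul_apply, Measure.restrict_apply hS, Measure.restrict_apply hS, Set.inter_self,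
      Set.inter_compl_self, measure_empty, smul_zero, add_zero]
    rfl
  rw [ae_iff]
  simpa only [not_lt] using hz

theorem ne_zero_of_corrupt_eq {ε : ℝ} (hε : ε ∈ Set.Ioo (0 : ℝ) 1) {x y : ℝ} {c : ℝ≥0}
    {H : ProbabilityMeasure ℝ}
    (h : corrupt ε (gaussian x) H = (1 - ε).toNNReal • maxGaussian c x y) : c ≠ 0 := by
  rintro rfl
  have := isProbabilityMeasure_corrupt hε.1.le hε.2.le (gaussian x) H
  have hm := congrArg (fun m : Measure ℝ => m.real Set.univ) h
  simp only [maxGaussian_zero, probReal_univ, measureReal_nnreal_smul_apply] at hm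
  rw [Real.coe_toNNReal _ (by linarith [hε.2])] at hm
  linarith [hε.1]

/-- The likelihood ratio of Huber's pair is `dη/dκ` clipped to `[c₁, 1/c₂]`. -/
theorem max_eq_max_mul_clip {a b c₁ c₂ : ℝ} (hb : 0 < b) (h₂ : 0 < c₂) (h : c₁ * c₂ ≤ 1) :
    max a (c₁ * b) = max b (c₂ * a) * max c₁ (min c₂⁻¹ (a / b)) := by
  have h₁ : c₁ ≤ c₂⁻¹ := by rwa [← one_div, le_div_iff₀ h₂]
  rcases le_total a (c₁ * b) with h3 | h3
  · have h4 : a / b ≤ c₁ := by rwa [div_le_iff₀ hb]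
    have h5 : c₂ * a ≤ b := by
      calc c₂ * a ≤ c₂ * (c₁ * b) := by gcongr
        _ = c₁ * c₂ * b := by ring
        _ ≤ b := mul_le_of_le_one_left hb.le h
    rw [max_eq_right h3, max_eq_left h5, min_eq_right (h4.trans h₁), max_eq_left h4]
    ring
  · have h4 : c₁ ≤ a / b := by rwa [le_div_iff₀ hb]
    rw [max_eq_left h3, max_eq_right (le_min h₁ h4)]
    rcases le_total (c₂ * a) b with h5 | h5
    · have h6 : a / b ≤ c₂⁻¹ := by
        rw [div_le_iff₀ hb, inv_mul_eq_div, le_div_iff₀ h₂]; linarith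
      rw [max_eq_left h5, min_eq_right h6]
      field_simp
    · have h6 : c₂⁻¹ ≤ a / b := by
        rw [le_div_iff₀ hb, inv_mul_eq_div, div_le_iff₀ h₂]; linarith
      rw [max_eq_right h5, min_eq_left h6]
      field_simp

theorem IsHuberPair.corruptKL_le {ε : ℝ} (hε : ε ∈ Set.Ioo (0 : ℝ) 1) {x y : ℝ}
    {H₁ H₂ : ProbabilityMeasure ℝ} (h : IsHuberPair ε x y H₁ H₂) (J J' : ProbabilityMeasure ℝ) :
    corruptKL ε x y H₁ H₂ ≤ corruptKL ε x y J J' := by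
  obtain ⟨c₁, c₂, hc, hH₁, hH₂⟩ := h
  rw [restrict_add_smul_restrict_compl_eq] at hH₁ hH₂
  have hc₁ : (0 : ℝ) < c₁ := NNReal.coe_pos.2 (pos_iff_ne_zero.2 (ne_zero_of_corrupt_eq hε hH₁))
  have hc₂ : (0 : ℝ) < c₂ := NNReal.coe_pos.2 (pos_iff_ne_zero.2 (ne_zero_of_corrupt_eq hε hH₂))
  have hcc : (c₁ : ℝ) * c₂ ≤ 1 := by exact_mod_cast hc
  have h₁₂ : (c₁ : ℝ) ≤ (c₂ : ℝ)⁻¹ := by rwa [← one_div, le_div_iff₀ hc₂]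
  have hpos : ∀ x t, 0 < gaussianPDFReal x 1 t := fun x t => gaussianPDFReal_pos x 1 t one_ne_zero
  set r : ℝ → ℝ := fun t =>
    max (c₁ : ℝ) (min (c₂ : ℝ)⁻¹ (gaussianPDFReal x 1 t / gaussianPDFReal y 1 t)) with hr
  have hrm : Measurable r := by fun_prop
  refine klDiv_corrupt_le_of_saddle hε.1.le hε.2.le hrm hc₁ (fun t => le_max_left _ _)
    (hi := (c₂ : ℝ)⁻¹) (fun t => max_le h₁₂ (min_le_left _ _)) ?_ ?_ ?_ J J'
  · rw [hH₁, hH₂, ← Measure.coe_nnreal_smul, ← Measure.coe_nnreal_smul,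
      withDensity_smul_measure, maxGaussian, maxGaussian,
      ← withDensity_mul _ (by fun_prop) (by fun_prop)]
    congr 2 with t
    rw [Pi.mul_apply, coe_mul_gaussianPDF, coe_mul_gaussianPDF, gaussianPDF, gaussianPDF,
      ← ENNReal.ofReal_max, ← ENNReal.ofReal_max,
      ← ENNReal.ofReal_mul ((hpos y t).le.trans (le_max_left _ _)),
      max_eq_max_mul_clip (hpos y t) hc₂ hcc]
  · filter_upwards [ae_lt_of_corrupt_eq hε.1 hH₁] with t ht
    have : gaussianPDFReal x 1 t / gaussianPDFReal y 1 t ≤ c₁ := by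
      rw [div_le_iff₀ (hpos y t)]; exact ht.le
    exact max_eq_left ((min_le_right _ _).trans this)
  · filter_upwards [ae_lt_of_corrupt_eq hε.1 hH₂] with t ht
    have : (c₂ : ℝ)⁻¹ ≤ gaussianPDFReal x 1 t / gaussianPDFReal y 1 t := by
      rw [le_div_iff₀ (hpos y t), inv_mul_eq_div, div_le_iff₀ hc₂]; linarith
    simp only [hr]
    rw [min_eq_left this, max_eq_right h₁₂]

theorem klG_le_corruptKL (ε x y : ℝ) (H H' : ProbabilityMeasure ℝ) :
    klG ε x y ≤ corruptKL ε x y H H' :=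
  iInf₂_le (f := fun H H' => corruptKL ε x y H H') H H'

theorem IsHuberPair.corruptKL_eq {ε : ℝ} (hε : ε ∈ Set.Ioo (0 : ℝ) 1) {x y : ℝ}
    {H₁ H₂ : ProbabilityMeasure ℝ} (h : IsHuberPair ε x y H₁ H₂) :
    corruptKL ε x y H₁ H₂ = klG ε x y :=
  le_antisymm (le_iInf₂ fun J J' => h.corruptKL_le hε J J') (klG_le_corruptKL ε x y H₁ H₂)

theorem continuous_maxGaussian_real_univ (x y : ℝ) :
    Continuous fun c : ℝ≥0 => (maxGaussian c x y).real Set.univ := by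
  refine (LipschitzWith.of_le_add fun c d => ?_).continuous
  have hle : maxGaussian c x y ≤ maxGaussian d x y + nndist c d • gaussianReal y 1 := by
    refine (maxGaussian_mono ?_ x y).trans (maxGaussian_add_le d (nndist c d) x y)
    rw [← NNReal.coe_le_coe, NNReal.coe_add, coe_nndist, NNReal.dist_eq]
    linarith [le_abs_self ((c : ℝ) - d)]
  have h : (maxGaussian c x y).real Set.univ ≤
      (maxGaussian d x y + nndist c d • gaussianReal y 1).real Set.univ :=
    ENNReal.toReal_mono (measure_ne_top _ _) (hle _)
  simpa [measureReal_add_apply, measureReal_nnreal_smul_apply] using h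

/-- A constant `c` for which `(1 - ε) max (dη, c dκ)` has mass one. -/
theorem exists_smul_maxGaussian_isProbabilityMeasure {ε : ℝ} (hε : ε ∈ Set.Ioo (0 : ℝ) 1)
    (x y : ℝ) :
    ∃ c : ℝ≥0, IsProbabilityMeasure ((1 - ε).toNNReal • maxGaussian c x y) := by
  have h1 : 0 < 1 - ε := by linarith [hε.2]
  have hv : 1 ≤ (1 - ε)⁻¹ := (one_le_inv₀ h1).2 (by linarith [hε.1])
  set v : ℝ≥0 := ((1 - ε)⁻¹).toNNReal with hvdef
  have hvcoe : (v : ℝ) = (1 - ε)⁻¹ := Real.coe_toNNReal _ (by positivity)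
  have hmem : (1 - ε)⁻¹ ∈ Set.Icc ((maxGaussian 0 x y).real Set.univ)
      ((maxGaussian v x y).real Set.univ) := by
    constructor
    · simpa [maxGaussian_zero] using hv
    · have : (v • gaussianReal y 1).real Set.univ ≤ (maxGaussian v x y).real Set.univ :=
        ENNReal.toReal_mono (measure_ne_top _ _) (smul_gaussianReal_le_maxGaussian v x y _)
      simpa [measureReal_nnreal_smul_apply, hvcoe] using this
  obtain ⟨c, -, hc⟩ := intermediate_value_Icc (zero_le (a := v))
    (continuous_maxGaussian_real_univ x y).continuousOn hmem
  refine ⟨c, ⟨?_⟩⟩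
  replace hc : (maxGaussian c x y).real Set.univ = (1 - ε)⁻¹ := hc
  rw [← ENNReal.toReal_eq_one_iff, ← measureReal_def, measureReal_nnreal_smul_apply, hc,
    Real.coe_toNNReal _ h1.le, mul_inv_cancel₀ h1.ne']

/-- If `(1 - ε) max (dη, dκ)` has mass at most one, then the corruptions can make the two laws
equal. -/
theorem exists_common_law {ε : ℝ} (hε : ε ∈ Set.Ioo (0 : ℝ) 1) {x y : ℝ}
    (h : (1 - ε).toNNReal * maxGaussian 1 x y Set.univ ≤ 1) :
    ∃ H H' : ProbabilityMeasure ℝ, corrupt ε (gaussian x) H = corrupt ε (gaussian y) H' ∧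
      ∃ C : ℝ≥0, corrupt ε (gaussian x) H ≤ C • (gaussianReal x 1 + gaussianReal y 1) := by
  set s : ℝ≥0 := (1 - ε).toNNReal
  set d : ℝ≥0∞ := 1 - s * maxGaussian 1 x y Set.univ with hd
  have hdtop : d ≠ ∞ := ENNReal.sub_ne_top ENNReal.one_ne_top
  set M : Measure ℝ := s • maxGaussian 1 x y + d.toNNReal • gaussianReal x 1 with hM
  have : IsProbabilityMeasure M := ⟨by
    rw [hM, Measure.add_apply, Measure.smul_apply, Measure.smul_apply, ENNReal.smul_def,
      ENNReal.smul_def, measure_univ (μ := gaussianReal x 1), smul_eq_mul, smul_eq_mul, mul_one,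
      ENNReal.coe_toNNReal hdtop, hd, add_tsub_cancel_of_le h]⟩
  have hx : s • (gaussian x : Measure ℝ) ≤ M :=
    Measure.le_add_right (nnreal_smul_measure_mono le_rfl (gaussianReal_le_maxGaussian 1 x y))
  have hy : s • (gaussian y : Measure ℝ) ≤ M := by
    refine Measure.le_add_right ?_
    rw [maxGaussian_one_comm]
    exact nnreal_smul_measure_mono le_rfl (gaussianReal_le_maxGaussian 1 y x)
  obtain ⟨H, hH⟩ := exists_corrupt_eq hε.1 hε.2.le (gaussian x) hx
  obtain ⟨H', hH'⟩ := exists_corrupt_eq hε.1 hε.2.le (gaussian y) hy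
  refine ⟨H, H', hH.trans hH'.symm, s + d.toNNReal, ?_⟩
  rw [hH, hM, add_smul]
  refine add_le_add (nnreal_smul_measure_mono le_rfl ?_)
    (nnreal_smul_measure_mono le_rfl (Measure.le_add_right le_rfl))
  simpa using maxGaussian_le_add 1 x y

theorem exists_isHuberPair {ε : ℝ} (hε : ε ∈ Set.Ioo (0 : ℝ) 1) {x y : ℝ}
    (h : 1 < (1 - ε).toNNReal * maxGaussian 1 x y Set.univ) :
    ∃ H₁ H₂ : ProbabilityMeasure ℝ, IsHuberPair ε x y H₁ H₂ := by
  have hlt : ∀ x y : ℝ, ∀ c : ℝ≥0, 1 < (1 - ε).toNNReal * maxGaussian 1 x y Set.univ →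
      IsProbabilityMeasure ((1 - ε).toNNReal • maxGaussian c x y) → c < 1 := by
    intro x y c h hc
    by_contra! hc1
    have hmass : (1 - ε).toNNReal * maxGaussian c x y Set.univ = 1 := by
      have := hc.measure_univ
      rwa [Measure.smul_apply, ENNReal.smul_def, smul_eq_mul] at this
    refine h.not_ge (le_of_le_of_eq ?_ hmass)
    gcongr
    exact maxGaussian_mono hc1 x y
  obtain ⟨c₁, hc₁⟩ := exists_smul_maxGaussian_isProbabilityMeasure hε x y
  obtain ⟨c₂, hc₂⟩ := exists_smul_maxGaussian_isProbabilityMeasure hε y x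
  have h₁ := hlt x y c₁ h hc₁
  have h₂ := hlt y x c₂ (by rwa [maxGaussian_one_comm]) hc₂
  obtain ⟨H₁, hH₁⟩ := exists_corrupt_eq hε.1 hε.2.le (gaussian x)
    (M := (1 - ε).toNNReal • maxGaussian c₁ x y)
    (nnreal_smul_measure_mono le_rfl (gaussianReal_le_maxGaussian c₁ x y))
  obtain ⟨H₂, hH₂⟩ := exists_corrupt_eq hε.1 hε.2.le (gaussian y)
    (M := (1 - ε).toNNReal • maxGaussian c₂ y x)
    (nnreal_smul_measure_mono le_rfl (gaussianReal_le_maxGaussian c₂ y x))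
  refine ⟨H₁, H₂, c₁, c₂, mul_le_one₀ h₁.le zero_le h₂.le, ?_, ?_⟩
  · rw [restrict_add_smul_restrict_compl_eq, hH₁]
  · rw [restrict_add_smul_restrict_compl_eq, hH₂]

theorem corruptKL_eq_zero_of_eq {ε x y : ℝ} (hε : ε ∈ Set.Ioo (0 : ℝ) 1)
    {H H' : ProbabilityMeasure ℝ}
    (h : corrupt ε (gaussian x) H = corrupt ε (gaussian y) H') : corruptKL ε x y H H' = 0 := by
  have := isProbabilityMeasure_corrupt hε.1.le hε.2.le (gaussian y) H'
  rw [corruptKL, h, klDiv_self]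

theorem exists_isHuberPair_of_klG_pos {ε : ℝ} (hε : ε ∈ Set.Ioo (0 : ℝ) 1) {x y : ℝ}
    (h : 0 < klG ε x y) : ∃ H₁ H₂ : ProbabilityMeasure ℝ, IsHuberPair ε x y H₁ H₂ := by
  refine exists_isHuberPair hε (not_le.1 fun hle => ?_)
  obtain ⟨H, H', heq, -⟩ := exists_common_law hε hle
  refine h.not_ge ((klG_le_corruptKL ε x y H H').trans ?_)
  rw [corruptKL_eq_zero_of_eq hε heq]

/-- The infimum defining `klG` is attained by a pair for which the first corrupted law is dominated
by Gaussian laws. -/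
theorem exists_corruptKL_eq_klG {ε : ℝ} (hε : ε ∈ Set.Ioo (0 : ℝ) 1) (x y : ℝ) :
    ∃ H H' : ProbabilityMeasure ℝ, corruptKL ε x y H H' = klG ε x y ∧
      ∃ C : ℝ≥0, corrupt ε (gaussian x) H ≤ C • (gaussianReal x 1 + gaussianReal y 1) := by
  by_cases h : (1 - ε).toNNReal * maxGaussian 1 x y Set.univ ≤ 1
  · obtain ⟨H, H', heq, hC⟩ := exists_common_law hε h
    refine ⟨H, H', le_antisymm ?_ (klG_le_corruptKL ε x y H H'), hC⟩
    rw [corruptKL_eq_zero_of_eq hε heq]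
    exact zero_le
  · obtain ⟨H, H', hHH'⟩ := exists_isHuberPair hε (not_le.1 h)
    refine ⟨H, H', hHH'.corruptKL_eq hε, ?_⟩
    obtain ⟨c₁, c₂, -, hH, -⟩ := hHH'
    rw [restrict_add_smul_restrict_compl_eq] at hH
    refine ⟨(1 - ε).toNNReal * max 1 c₁, ?_⟩
    rw [hH, mul_smul]
    refine nnreal_smul_measure_mono le_rfl ((maxGaussian_le_add c₁ x y).trans ?_)
    rw [smul_add]
    refine add_le_add ?_ (nnreal_smul_measure_mono (le_max_right _ _) le_rfl)
    simpa using nnreal_smul_measure_mono (le_max_left 1 c₁) (le_refl (gaussianReal x 1))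

end GaussianHuber

/-! ### Continuity of the divergence in the optimal mean -/

section Continuity

open InformationTheory

theorem gaussianPDFReal_le_exp_mul {y z t w : ℝ} (hw : |y - z| * (|t| + (|y| + |z|)) ≤ w) :
    gaussianPDFReal y 1 t ≤ Real.exp w * gaussianPDFReal z 1 t := by
  have hexp : -(t - y) ^ 2 / (2 * (1 : ℝ)) ≤ w + -(t - z) ^ 2 / (2 * (1 : ℝ)) := by
    have h1 : (y - z) * (t - (y + z) / 2) ≤ |y - z| * (|t| + (|y| + |z|)) := by
      refine (le_abs_self _).trans ?_
      rw [abs_mul]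
      gcongr
      refine abs_le.2 ⟨?_, ?_⟩ <;>
        linarith [abs_nonneg y, abs_nonneg z, le_abs_self t, neg_abs_le t, le_abs_self y,
          neg_abs_le y, le_abs_self z, neg_abs_le z]
    nlinarith
  rw [gaussianPDFReal, gaussianPDFReal, mul_left_comm, ← Real.exp_add]
  simp only [NNReal.coe_one]
  gcongr

/-- Two Gaussian laws with nearby means have corrupted laws, for the same corruption, whose
log-likelihood ratio is at most linear. -/
theorem corrupt_gaussian_le_withDensity (ε : ℝ) (y z : ℝ) (H : ProbabilityMeasure ℝ) {w : ℝ → ℝ}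
    (hwm : Measurable w) (hw : ∀ t, |y - z| * (|t| + (|y| + |z|)) ≤ w t) :
    corrupt ε (gaussian y) H ≤
      (corrupt ε (gaussian z) H).withDensity fun t => ENNReal.ofReal (Real.exp (w t)) := by
  have hw0 : ∀ t, 0 ≤ w t := fun t => le_trans (by positivity) (hw t)
  have hg : gaussianReal y 1 ≤
      (gaussianReal z 1).withDensity fun t => ENNReal.ofReal (Real.exp (w t)) := by
    rw [gaussianReal_eq_withDensity, gaussianReal_eq_withDensity,
      ← withDensity_mul _ (by fun_prop) (by fun_prop)]
    refine withDensity_mono (ae_of_all _ fun t => ?_)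
    rw [Pi.mul_apply, gaussianPDF, gaussianPDF,
      ← ENNReal.ofReal_mul (gaussianPDFReal_nonneg _ _ _), mul_comm]
    exact ENNReal.ofReal_le_ofReal (gaussianPDFReal_le_exp_mul (hw t))
  have hH : (H : Measure ℝ) ≤
      (H : Measure ℝ).withDensity fun t => ENNReal.ofReal (Real.exp (w t)) := by
    conv_lhs => rw [← withDensity_one (μ := (H : Measure ℝ))]
    refine withDensity_mono (ae_of_all _ fun t => ?_)
    simpa using hw0 t
  rw [corrupt, corrupt, withDensity_add_measure, ← Measure.coe_nnreal_smul,
    ← Measure.coe_nnreal_smul, ← Measure.coe_nnreal_smul, withDensity_smul_measure,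
    withDensity_smul_measure]
  simp only [Measure.coe_nnreal_smul]
  exact add_le_add (nnreal_smul_measure_mono le_rfl hg) (nnreal_smul_measure_mono le_rfl hH)

theorem integrable_abs_of_le {P : Measure ℝ} {C : ℝ≥0} {x y : ℝ}
    (h : P ≤ C • (gaussianReal x 1 + gaussianReal y 1)) : Integrable (fun t => |t|) P := by
  have hg : ∀ x : ℝ, Integrable (fun t => |t|) (gaussianReal x 1) := fun x =>
    ((memLp_id_gaussianReal 1).integrable (by simp)).abs
  exact (((hg x).add_measure (hg y)).smul_measure_nnreal).mono_measure h

/-- For suitable fixed corruptions, which are optimal for the means `x`, `y`, the divergence is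
upper semicontinuous in the second mean at `y`. -/
theorem exists_forall_corruptKL_le {ε : ℝ} (hε : ε ∈ Set.Ioo (0 : ℝ) 1) (x y : ℝ) :
    ∃ (H H' : ProbabilityMeasure ℝ) (C : ℝ), 0 ≤ C ∧ ∀ δ : ℝ, 0 < δ → δ ≤ 1 →
      ∀ z ∈ Set.Ioo y (y + δ), corruptKL ε x z H H' ≤ klG ε x y + ENNReal.ofReal (δ * C) := by
  obtain ⟨H, H', heq, A, hA⟩ := exists_corruptKL_eq_klG hε x y
  have hprob := fun P H => isProbabilityMeasure_corrupt hε.1.le hε.2.le P H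
  have habs : Integrable (fun t => |t|) (corrupt ε (gaussian x) H) := integrable_abs_of_le hA
  have hint : Integrable (fun t => |t| + (2 * |y| + 1)) (corrupt ε (gaussian x) H) :=
    habs.add (integrable_const _)
  refine ⟨H, H', ∫ t, (|t| + (2 * |y| + 1)) ∂corrupt ε (gaussian x) H,
    integral_nonneg fun t => by positivity, fun δ hδ hδ1 z hz => ?_⟩
  have hzabs : |z| ≤ |y| + 1 := by
    have := abs_sub_abs_le_abs_sub z y
    rw [abs_of_pos (sub_pos.2 hz.1)] at this
    linarith [hz.2]
  have hyz : |y - z| ≤ δ := by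
    rw [abs_sub_comm, abs_of_pos (sub_pos.2 hz.1)]; linarith [hz.2]
  have hw : ∀ t : ℝ, |y - z| * (|t| + (|y| + |z|)) ≤ δ * (|t| + (2 * |y| + 1)) := fun t => by
    exact mul_le_mul hyz (by linarith) (by positivity) hδ.le
  have hw' : ∀ t : ℝ, |z - y| * (|t| + (|z| + |y|)) ≤ δ * (|t| + (2 * |y| + 1)) := fun t => by
    rw [abs_sub_comm, add_comm |z|]; exact hw t
  have hwm : Measurable fun t : ℝ => δ * (|t| + (2 * |y| + 1)) := by fun_prop
  have h := klDiv_le_klDiv_add_integral (corrupt ε (gaussian x) H) (corrupt ε (gaussian y) H')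
    (corrupt ε (gaussian z) H') (hint.const_mul δ)
    (corrupt_gaussian_le_withDensity ε y z H' hwm hw)
    (corrupt_gaussian_le_withDensity ε z y H' hwm hw')
  rw [integral_const_mul] at h
  rw [← heq]
  exact h

end Continuity

/-! ### Instances in which arm `a` is made optimal -/

section Instances

theorem mean_gaussian (x : ℝ) : mean (gaussian x) = x := integral_id_gaussianReal

theorem eq_gaussian_mean {P : ProbabilityMeasure ℝ} (hP : P ∈ gaussianFamily) :
    P = gaussian (mean P) := by
  obtain ⟨x, rfl⟩ := hP
  rw [mean_gaussian]

variable {K : ℕ}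

theorem mean_le_bestMean (μ : Fin K → ProbabilityMeasure ℝ) (a : Fin K) : mean (μ a) ≤ bestMean μ :=
  le_ciSup (f := fun a => mean (μ a)) (Set.finite_range _).bddAbove a

theorem mean_update_lt_bestMean {μ : Fin K → ProbabilityMeasure ℝ} {a : Fin K} {y : ℝ}
    (hy : bestMean μ < y) {b : Fin K} (hb : b ≠ a) :
    mean (Function.update μ a (gaussian y) b) < bestMean (Function.update μ a (gaussian y)) := by
  have h := mean_le_bestMean (Function.update μ a (gaussian y)) a
  rw [Function.update_self, mean_gaussian] at h
  rw [Function.update_of_ne hb]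
  exact (mean_le_bestMean μ b).trans_lt (hy.trans_le h)

theorem update_mem_instances {L : Set (ProbabilityMeasure ℝ)} {μ : Fin K → ProbabilityMeasure ℝ}
    (hμ : μ ∈ instances K L) (a : Fin K) {P : ProbabilityMeasure ℝ} (hP : P ∈ L) :
    Function.update μ a P ∈ instances K L := fun b => by
  rcases eq_or_ne b a with rfl | hb
  · simpa using hP
  · simpa [hb] using hμ b

theorem one_div_klG_le_pullRate {ε : ℝ} (hε : ε ∈ Set.Ioo (0 : ℝ) 1) (π : Algorithm K)
    {I : Set (Fin K → ProbabilityMeasure ℝ)} (hI : UniformlyGoodOn ε I π)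
    {μ : Fin K → ProbabilityMeasure ℝ} (hμ : μ ∈ I) {a : Fin K} (hμa : μ a ∈ gaussianFamily)
    (ha : mean (μ a) < bestMean μ)
    (hclose : ∀ δ : ℝ, 0 < δ → ∃ y ∈ Set.Ioo (bestMean μ) (bestMean μ + δ),
      Function.update μ a (gaussian y) ∈ I) :
    1 / klG ε (mean (μ a)) (bestMean μ) ≤ pullRate ε π μ a := by
  obtain ⟨H, H', C, hC, hle⟩ := exists_forall_corruptKL_le hε (mean (μ a)) (bestMean μ)
  have key : ∀ δ ∈ Set.Ioo (0 : ℝ) 1,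
      1 / (klG ε (mean (μ a)) (bestMean μ) + ENNReal.ofReal (δ * C)) ≤ pullRate ε π μ a := by
    intro δ hδ
    obtain ⟨y, hy, hyI⟩ := hclose δ hδ.1
    have hrate := one_div_klDiv_le_pullRate hε.1.le hε.2.le π μ a (gaussian y) H H' (hI μ hμ a ha)
      fun b hb => hI _ hyI b (mean_update_lt_bestMean hy.1 hb)
    rw [eq_gaussian_mean hμa] at hrate
    exact (ENNReal.div_le_div_left (hle δ hδ.1 hδ.2.le y hy) 1).trans hrate
  have hlim : Tendsto (fun δ : ℝ =>
      1 / (klG ε (mean (μ a)) (bestMean μ) + ENNReal.ofReal (δ * C))) (𝓝[>] 0)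
      (𝓝 (1 / klG ε (mean (μ a)) (bestMean μ))) := by
    have hcont : Continuous fun δ : ℝ =>
        (klG ε (mean (μ a)) (bestMean μ) + ENNReal.ofReal (δ * C))⁻¹ :=
      (continuous_const.add (ENNReal.continuous_ofReal.comp (by fun_prop))).inv
    simpa using (hcont.tendsto 0).mono_left nhdsWithin_le_nhds
  refine le_of_tendsto hlim ?_
  filter_upwards [Ioo_mem_nhdsGT one_pos] with δ hδ using key δ hδ

end Instances

end CorruptedBandit

theorem proposition1 (ε : ℝ) (hε : ε ∈ Set.Ioo (0 : ℝ) (1 / 2)) :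
    -- the lower bound for algorithms that are uniformly good on all Gaussian instances
    (∀ (K : ℕ) (π : Algorithm K),
      UniformlyGood ε gaussianFamily π →
      ∀ μ ∈ instances K gaussianFamily, ∀ a : Fin K,
        mean (μ a) < bestMean μ →
        1 / klG ε (mean (μ a)) (bestMean μ) ≤
          pullRate ε π μ a) ∧
    -- the same bound at `μ`, `a` when the algorithm is only asked to be uniformly good on a class
    -- `I` of Gaussian instances that contains `μ` and instances in which arm `a` is made optimal
    -- by an arbitrarily small margin
    (∀ (K : ℕ) (π : Algorithm K)
      (I : Set (Fin K → ProbabilityMeasure ℝ)),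
      I ⊆ instances K gaussianFamily →
      UniformlyGoodOn ε I π →
      ∀ μ ∈ I, ∀ a : Fin K,
        mean (μ a) < bestMean μ →
        (∀ δ : ℝ, 0 < δ → ∃ y ∈ Set.Ioo (bestMean μ)
            (bestMean μ + δ),
          Function.update μ a (gaussian y) ∈ I) →
        1 / klG ε (mean (μ a)) (bestMean μ) ≤
          pullRate ε π μ a) ∧
    -- the infimum defining `kl^ε_G` is attained, and Huber's pair attains it
    (∀ x y : ℝ, x ≤ y →
      (∃ H H' : ProbabilityMeasure ℝ,
        corruptKL ε x y H H' = klG ε x y) ∧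
      (∀ H₁ H₂ : ProbabilityMeasure ℝ, IsHuberPair ε x y H₁ H₂ →
        corruptKL ε x y H₁ H₂ = klG ε x y) ∧
      (0 < klG ε x y →
        ∃ H₁ H₂ : ProbabilityMeasure ℝ, IsHuberPair ε x y H₁ H₂)) := by
  have hε1 : ε ∈ Set.Ioo (0 : ℝ) 1 := ⟨hε.1, hε.2.trans (by norm_num)⟩
  refine ⟨fun K π hπ μ hμ a ha => ?_, fun K π I hI hπ μ hμ a ha hclose => ?_, fun x y _ => ?_⟩
  · refine one_div_klG_le_pullRate hε1 π hπ hμ (hμ a) ha fun δ hδ => ?_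
    exact ⟨bestMean μ + δ / 2, ⟨by linarith, by linarith⟩, update_mem_instances hμ a ⟨_, rfl⟩⟩
  · exact one_div_klG_le_pullRate hε1 π hπ hμ (hI hμ a) ha hclose
  · obtain ⟨H, H', h, -⟩ := exists_corruptKL_eq_klG hε1 x y
    exact ⟨⟨H, H', h⟩, fun H₁ H₂ hH => hH.corruptKL_eq hε1, exists_isHuberPair_of_klG_pos hε1⟩
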